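/- **Gelfand–Naĭmark Theorem.** Let $A$ be a (complex, not necessarily unital) C\*-algebra. A *state* on $A$ is a linear functional $\psi : A \to \mathbb{C}$ such that $\psi(a^*a) \ge 0$ for all $a \in A$ ($\psi$ is positive), such that for each $b \in A$ the functional $a \mapsto \psi(b^*ab)$ is continuous on the set of Hermitian elements of $A$, and such that $\psi$ has finite variation $$v(\psi) := \inf\{v \ge 0 : |\psi(a)|^2 \le v\,\psi(a^*a) \text{ for all } a \in A\} = 1 .$$ Let $S(A)$ be the set of states on $A$. For $\psi \in S(A)$ let $\pi_\psi$ be the GNS representation of $A$ in the Hilbert space $H_\psi$ associated with $\psi$: $H_\psi$ is the Hilbert space completion of $A$ for the form $\langle a, b\rangle_\psi = \psi(b^*a)$ (modulo its null space), and $\pi_\psi(a)$ extends left multiplication by $a$. Let $\pi_u := \bigoplus_{\psi \in S(A)} \pi_\psi$ be the universal representation of $A$ in the Hilbert space $H_u := \bigoplus_{\psi \in S(A)} H_\psi$. Put $\|a\|_o := \sup_{\psi \in S(A)} \psi(a^*a)^{1/2}$ for $a \in A$ (with $\|a\|_o := 0$ if $S(A) = \emptyset$). Let the enveloping C\*-algebra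 $C^*(A)$ be the completion of the quotient of $A$ by the two-sided \*-ideal $\{a \in A : \|a\|_o = 0\}$ in the norm induced by $\|\cdot\|_o$, and let $j : A \to C^*(A)$ be the canonical \*-homomorphism. Then: 1. $\|\pi_u(a)\| = \|a\|_o = \|a\|$ for all $a \in A$. 2. The range $\pi_u(A)$ is a closed \*-subalgebra of $B(H_u)$, and $\pi_u$ is an isometric \*-isomorphism of $A$ onto $\pi_u(A)$. In particular, $A$ is isomorphic as a C\*-algebra to a C\*-algebra of bounded linear operators on a Hilbert space. 3. The map $j$ is an isometric \*-isomorphism of $A$ onto $C^*(A)$, so that $C^*(A)$ can be identified with $A$. -/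

import Mathlib

noncomputable section

namespace GelfandNaimark

open scoped ComplexOrder InnerProductSpace Topology
open UniformSpace Filter

/-! ### States and the seminorm they define -/

section States

variable {A : Type*} [NonUnitalNormedRing A] [NormedSpace ℂ A] [StarRing A]

/-- A linear functional `φ` is positive if `φ(a* a) ≥ 0` for all `a`. -/
def IsPositive (φ : A →ₗ[ℂ] ℂ) : Prop :=
  ∀ a : A, 0 ≤ φ (star a * a)

/-- `φ` is weakly continuous on the Hermitian part of `A`: for each `b`, the functional
`a ↦ φ(b* a b)` is continuous on the set of Hermitian elements. -/
def IsWeaklyContinuousOnSelfAdjoint (φ : A →ₗ[ℂ] ℂ) : Prop :=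
  ∀ b : A, ContinuousOn (fun a : A => φ (star b * a * b)) {a : A | IsSelfAdjoint a}

/-- The set of all `v ≥ 0` with `|φ(a)|² ≤ v φ(a* a)` for all `a`. -/
def variationBounds (φ : A →ₗ[ℂ] ℂ) : Set ℝ :=
  {v : ℝ | 0 ≤ v ∧ ∀ a : A, ‖φ a‖ ^ 2 ≤ v * (φ (star a * a)).re}

/-- `φ` has finite variation. -/
def HasFiniteVariation (φ : A →ₗ[ℂ] ℂ) : Prop :=
  (variationBounds φ).Nonempty

/-- The variation of `φ` (meaningful if `φ` has finite variation). -/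
def variation (φ : A →ₗ[ℂ] ℂ) : ℝ :=
  sInf (variationBounds φ)

/-- A state is a positive linear functional that is weakly continuous on the Hermitian part
and has finite variation equal to `1`. -/
structure IsState (ψ : A →ₗ[ℂ] ℂ) : Prop where
  isPositive : IsPositive ψ
  weaklyContinuous : IsWeaklyContinuousOnSelfAdjoint ψ
  hasFiniteVariation : HasFiniteVariation ψ
  variation_eq_one : variation ψ = 1

variable (A) in
/-- The set `S(A)` of states, as a type. -/
def State : Type _ := {ψ : A →ₗ[ℂ] ℂ // IsState ψ}

/-- `‖a‖_o`, the supremum of `ψ(a* a)^{1/2}` over all states `ψ` (and `0` if there are none). -/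
def gnSeminorm (a : A) : ℝ :=
  ⨆ ψ : State A, √(ψ.1 (star a * a)).re

theorem IsState.norm_sq_le {ψ : A →ₗ[ℂ] ℂ} (h : IsState ψ) (a : A) :
    ‖ψ a‖ ^ 2 ≤ (ψ (star a * a)).re := by
  have hcl : IsClosed (variationBounds ψ) := by
    have : variationBounds ψ = Set.Ici 0 ∩
        ⋂ a : A, {v : ℝ | ‖ψ a‖ ^ 2 ≤ v * (ψ (star a * a)).re} := by
      ext v; simp [variationBounds]
    rw [this]
    exact isClosed_Ici.inter (isClosed_iInter fun a =>
      isClosed_le continuous_const (by fun_prop))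
  have := hcl.csInf_mem h.hasFiniteVariation ⟨0, fun v hv => hv.1⟩
  have h1 : sInf (variationBounds ψ) = 1 := h.variation_eq_one
  rw [h1] at this
  simpa using this.2 a

end States

/-! ### The universal representation -/

section CStar

variable {A : Type*} [NonUnitalCStarAlgebra A]

/-- A C*-algebra carries its canonical order, in which the nonnegative elements are
those of the form `a* a`. -/
local instance (priority := 50) : PartialOrder A := CStarAlgebra.spectralOrder A

local instance (priority := 50) : StarOrderedRing A := CStarAlgebra.spectralOrderedRing A

/-- A state, bundled as a positive linear map into `ℂ`. -/
def State.toPositive (ψ : State A) : A →ₚ[ℂ] ℂ :=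
  PositiveLinearMap.mk₀ ψ.1 fun x hx => by
    obtain ⟨b, rfl⟩ := CStarAlgebra.nonneg_iff_eq_star_mul_self.mp hx
    exact ψ.2.isPositive b

theorem State.toPositive_apply (ψ : State A) (a : A) : ψ.toPositive a = ψ.1 a := rfl

/-- The Hilbert space `H_ψ`, the completion of `A` for the form `⟨a, b⟩ = ψ(a* b)`. -/
abbrev State.GNSSpace (ψ : State A) : Type _ := ψ.toPositive.GNS

/-- The GNS representation `π_ψ`, given on the dense image of `A` by left multiplication. -/
def State.gnsRep (ψ : State A) : A →⋆ₙₐ[ℂ] (ψ.GNSSpace →L[ℂ] ψ.GNSSpace) :=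
  ψ.toPositive.gnsNonUnitalStarAlgHom

variable (A) in
/-- The universal Hilbert space: the Hilbert direct sum of the `H_ψ` over all states `ψ`. -/
abbrev UniversalSpace : Type _ := lp (fun ψ : State A => ψ.GNSSpace) 2

theorem State.norm_gnsRep_le (ψ : State A) (a : A) : ‖ψ.gnsRep a‖ ≤ ‖a‖ :=
  NonUnitalStarAlgHom.norm_apply_le ψ.gnsRep a

variable (A) in
/-- The universal representation: the direct sum of the GNS representations of all states,
acting by `(π_u(a) x)_ψ = π_ψ(a) x_ψ`. -/
def universalRep : A →⋆ₙₐ[ℂ] (UniversalSpace A →L[ℂ] UniversalSpace A) where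
  toFun a := lp.mapCLM 2 (fun ψ : State A => ψ.gnsRep a) (norm_nonneg a)
    fun ψ => ψ.norm_gnsRep_le a
  map_smul' c a := by ext x ψ; simp
  map_zero' := by ext x ψ; simp
  map_add' a b := by ext x ψ; simp
  map_mul' a b := by ext x ψ; simp
  map_star' a := by
    refine (ContinuousLinearMap.eq_adjoint_iff _ _).mpr fun x y => ?_
    simp only [lp.inner_eq_tsum]
    refine tsum_congr fun ψ => ?_
    simp [map_star, ContinuousLinearMap.star_eq_adjoint, ContinuousLinearMap.adjoint_inner_left]

theorem universalRep_apply (a : A) (x : UniversalSpace A) (ψ : State A) :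
    (universalRep A a x) ψ = ψ.gnsRep a (x ψ) := rfl

/-! ### The seminorm is an algebra seminorm with the C*-property -/

theorem State.gns_norm (ψ : State A) (a : A) :
    ‖ψ.toPositive.toPreGNS a‖ = √(ψ.1 (star a * a)).re := rfl

theorem State.re_nonneg (ψ : State A) (a : A) : 0 ≤ (ψ.1 (star a * a)).re :=
  (Complex.nonneg_iff.mp (ψ.2.isPositive a)).1

theorem State.continuous (ψ : State A) : Continuous ψ.1 :=
  map_continuous ψ.toPositive

theorem State.sqrt_le_norm (ψ : State A) (a : A) : √(ψ.1 (star a * a)).re ≤ ‖a‖ := by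
  let f : A →L[ℂ] ℂ := ⟨ψ.1, ψ.continuous⟩
  have hf : ∀ a, ‖f a‖ ^ 2 ≤ ‖f‖ * ‖a‖ ^ 2 := fun a => by
    calc ‖f a‖ ^ 2 ≤ (f (star a * a)).re := ψ.2.norm_sq_le a
      _ ≤ ‖f (star a * a)‖ := Complex.re_le_norm _
      _ ≤ ‖f‖ * ‖star a * a‖ := f.le_opNorm _
      _ = ‖f‖ * ‖a‖ ^ 2 := by rw [CStarRing.norm_star_mul_self, sq]
  have h1 : ‖f‖ ≤ √‖f‖ := f.opNorm_le_bound (Real.sqrt_nonneg _) fun a => by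
    have := Real.sqrt_le_sqrt (hf a)
    rwa [Real.sqrt_sq (norm_nonneg _), Real.sqrt_mul (norm_nonneg _),
      Real.sqrt_sq (norm_nonneg _)] at this
  have h2 : ‖f‖ ≤ 1 := by
    have h3 := Real.sq_sqrt (norm_nonneg f)
    have h4 := Real.sqrt_nonneg ‖f‖
    nlinarith
  refine Real.sqrt_le_iff.mpr ⟨norm_nonneg _, ?_⟩
  calc (f (star a * a)).re ≤ ‖f (star a * a)‖ := Complex.re_le_norm _
      _ ≤ ‖f‖ * ‖star a * a‖ := f.le_opNorm _
      _ = ‖f‖ * ‖a‖ ^ 2 := by rw [CStarRing.norm_star_mul_self, sq]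
      _ ≤ ‖a‖ ^ 2 := by nlinarith [sq_nonneg ‖a‖]

/-- The supremum that defines `‖a‖_o` is over a bounded set. -/
theorem bddAbove_gnSeminorm (a : A) :
    BddAbove (Set.range fun ψ : State A => √(ψ.1 (star a * a)).re) :=
  ⟨‖a‖, by rintro _ ⟨ψ, rfl⟩; exact ψ.sqrt_le_norm a⟩

theorem State.sqrt_le_gnSeminorm (ψ : State A) (a : A) :
    √(ψ.1 (star a * a)).re ≤ gnSeminorm a :=
  le_ciSup (bddAbove_gnSeminorm a) ψ

theorem gnSeminorm_nonneg (a : A) : 0 ≤ gnSeminorm a :=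
  Real.iSup_nonneg fun _ => Real.sqrt_nonneg _

theorem gnSeminorm_zero : gnSeminorm (0 : A) = 0 := by
  simp [gnSeminorm]

theorem gnSeminorm_neg (a : A) : gnSeminorm (-a) = gnSeminorm a := by
  simp [gnSeminorm]

theorem gnSeminorm_add_le (a b : A) : gnSeminorm (a + b) ≤ gnSeminorm a + gnSeminorm b := by
  refine Real.iSup_le (fun ψ => ?_) (add_nonneg (gnSeminorm_nonneg a) (gnSeminorm_nonneg b))
  rw [← ψ.gns_norm, map_add]
  exact (norm_add_le _ _).trans
    (add_le_add (ψ.sqrt_le_gnSeminorm a) (ψ.sqrt_le_gnSeminorm b))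

theorem gnSeminorm_smul_le (c : ℂ) (a : A) : gnSeminorm (c • a) ≤ ‖c‖ * gnSeminorm a := by
  refine Real.iSup_le (fun ψ => ?_) (mul_nonneg (norm_nonneg c) (gnSeminorm_nonneg a))
  rw [← ψ.gns_norm, map_smul, norm_smul]
  exact mul_le_mul_of_nonneg_left (ψ.sqrt_le_gnSeminorm a) (norm_nonneg c)

/-- The normalised vector functional `a ↦ ψ(b* a b) / ψ(b* b)` is a state. -/
theorem State.isState_conj (ψ : State A) (b : A) (hb : 0 < (ψ.1 (star b * b)).re) :
    IsState (((ψ.1 (star b * b)).re⁻¹ : ℂ) •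
      (ψ.1 ∘ₗ LinearMap.mulRight ℂ b ∘ₗ LinearMap.mulLeft ℂ (star b))) := by
  set r : ℝ := (ψ.1 (star b * b)).re with hr
  set φ : A →ₗ[ℂ] ℂ := ((r⁻¹ : ℂ) •
      (ψ.1 ∘ₗ LinearMap.mulRight ℂ b ∘ₗ LinearMap.mulLeft ℂ (star b))) with hφ
  have hrφ (a : A) : φ a = (r⁻¹ : ℂ) * ψ.1 (star b * a * b) := by
    simp [hφ]
  have hψc := ψ.continuous
  have hφc : Continuous φ := by
    have : (φ : A → ℂ) = fun a => (r⁻¹ : ℂ) * ψ.1 (star b * a * b) := funext hrφ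
    rw [this]
    fun_prop
  have hre (a : A) : (φ (star a * a)).re = r⁻¹ * (ψ.1 (star (a * b) * (a * b))).re := by
    rw [hrφ, ← Complex.ofReal_inv, Complex.re_ofReal_mul, star_mul]
    simp only [mul_assoc]
  have hone : (1 : ℝ) ∈ variationBounds φ := by
    refine ⟨zero_le_one, fun a => ?_⟩
    have hcs : ‖ψ.1 (star b * (a * b))‖ ^ 2 ≤ r * (ψ.1 (star (a * b) * (a * b))).re := by
      have h := norm_inner_le_norm (𝕜 := ℂ) (ψ.toPositive.toPreGNS b)
        (ψ.toPositive.toPreGNS (a * b))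
      rw [ψ.gns_norm, ψ.gns_norm] at h
      have h' := pow_le_pow_left₀ (norm_nonneg _) h 2
      rw [mul_pow, Real.sq_sqrt (ψ.re_nonneg _), Real.sq_sqrt (ψ.re_nonneg _)] at h'
      exact h'
    rw [hre, hrφ, norm_mul, mul_pow, mul_assoc (star b), ← Complex.ofReal_inv, Complex.norm_real,
      Real.norm_of_nonneg (inv_nonneg.mpr hb.le), one_mul]
    calc r⁻¹ ^ 2 * ‖ψ.1 (star b * (a * b))‖ ^ 2
        ≤ r⁻¹ ^ 2 * (r * (ψ.1 (star (a * b) * (a * b))).re) := by gcongr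
      _ = r⁻¹ * (ψ.1 (star (a * b) * (a * b))).re := by
        field_simp
  refine ⟨fun a => ?_, fun c => ?_, ⟨1, hone⟩, ?_⟩
  · rw [hrφ, ← Complex.ofReal_inv]
    refine mul_nonneg (Complex.zero_le_real.mpr (inv_nonneg.mpr hb.le)) ?_
    have := ψ.2.isPositive (a * b)
    rwa [star_mul, mul_assoc, ← mul_assoc (star a), ← mul_assoc] at this
  · exact Continuous.continuousOn (by fun_prop)
  · refine le_antisymm (csInf_le ⟨0, fun v hv => hv.1⟩ hone) (le_csInf ⟨1, hone⟩ fun v hv => ?_)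
    have hl := (CStarAlgebra.increasingApproximateUnit A)
    have hlim : Tendsto (fun e : A => e * b) (CStarAlgebra.approximateUnit A) (𝓝 b) :=
      hl.tendsto_mul_right b
    have hself : ψ.1 (star b * b) = (r : ℂ) := by
      apply Complex.ext
      · simp [hr]
      · simpa using (Complex.nonneg_iff.mp (ψ.2.isPositive b)).2.symm
    have h1 : Tendsto (fun e : A => ‖φ e‖ ^ 2) (CStarAlgebra.approximateUnit A) (𝓝 1) := by
      have : Tendsto (fun e : A => ‖(r⁻¹ : ℂ) * ψ.1 (star b * (e * b))‖ ^ 2)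
          (CStarAlgebra.approximateUnit A) (𝓝 (‖(r⁻¹ : ℂ) * ψ.1 (star b * b)‖ ^ 2)) :=
        ((by fun_prop : Continuous fun x : A =>
          ‖(r⁻¹ : ℂ) * ψ.1 (star b * x)‖ ^ 2).tendsto b).comp hlim
      rw [hself, inv_mul_cancel₀ (by exact_mod_cast hb.ne')] at this
      simpa [hrφ, mul_assoc] using this
    have h2 : Tendsto (fun e : A => v * (φ (star e * e)).re)
        (CStarAlgebra.approximateUnit A) (𝓝 v) := by
      have : Tendsto (fun e : A => v * (r⁻¹ * (ψ.1 (star (e * b) * (e * b))).re))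
          (CStarAlgebra.approximateUnit A) (𝓝 (v * (r⁻¹ * (ψ.1 (star b * b)).re))) :=
        ((by fun_prop : Continuous fun x : A =>
          v * (r⁻¹ * (ψ.1 (star x * x)).re)).tendsto b).comp hlim
      rw [← hr, inv_mul_cancel₀ hb.ne', mul_one] at this
      simpa only [hre] using this
    exact le_of_tendsto_of_tendsto' h1 h2 hv.2

theorem State.sqrt_mul_le (ψ : State A) (a b : A) :
    √(ψ.1 (star (a * b) * (a * b))).re ≤ gnSeminorm a * √(ψ.1 (star b * b)).re := by
  rcases (ψ.re_nonneg b).eq_or_lt with hb | hb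
  · have h := (ψ.toPositive.leftMulMapPreGNS a).le_opNorm (ψ.toPositive.toPreGNS b)
    rw [ψ.gns_norm b, ← hb, Real.sqrt_zero, mul_zero] at h
    rw [← hb, Real.sqrt_zero, mul_zero]
    exact h
  · have h := State.sqrt_le_gnSeminorm ⟨_, ψ.isState_conj b hb⟩ a
    have e : √(ψ.1 (star (a * b) * (a * b))).re
        = √((((ψ.1 (star b * b)).re⁻¹ : ℂ) •
      (ψ.1 ∘ₗ LinearMap.mulRight ℂ b ∘ₗ LinearMap.mulLeft ℂ (star b))) (star a * a)).re
          * √(ψ.1 (star b * b)).re := by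
      rw [← Real.sqrt_mul' _ hb.le]
      congr 1
      simp only [LinearMap.smul_apply, LinearMap.comp_apply, LinearMap.mulRight_apply,
        LinearMap.mulLeft_apply, smul_eq_mul, star_mul]
      rw [← Complex.ofReal_inv, Complex.re_ofReal_mul]
      simp only [mul_assoc]
      field_simp
    rw [e]
    exact mul_le_mul_of_nonneg_right h (Real.sqrt_nonneg _)

theorem gnSeminorm_mul_le (a b : A) : gnSeminorm (a * b) ≤ gnSeminorm a * gnSeminorm b :=
  Real.iSup_le (fun ψ => (ψ.sqrt_mul_le a b).trans
    (mul_le_mul_of_nonneg_left (ψ.sqrt_le_gnSeminorm b) (gnSeminorm_nonneg a)))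
    (mul_nonneg (gnSeminorm_nonneg a) (gnSeminorm_nonneg b))

theorem gnSeminorm_mul_self_le (a : A) :
    gnSeminorm a * gnSeminorm a ≤ gnSeminorm (star a * a) := by
  have h : gnSeminorm a ≤ √(gnSeminorm (star a * a)) :=
    Real.iSup_le (fun ψ => Real.sqrt_le_sqrt
      ((Complex.re_le_norm _).trans ((Real.le_sqrt (norm_nonneg _) (ψ.re_nonneg _)).mpr
        (ψ.2.norm_sq_le _) |>.trans (ψ.sqrt_le_gnSeminorm _)))) (Real.sqrt_nonneg _)
  calc _ ≤ √(gnSeminorm (star a * a)) * √(gnSeminorm (star a * a)) :=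
        mul_self_le_mul_self (gnSeminorm_nonneg a) h
    _ = _ := Real.mul_self_sqrt (gnSeminorm_nonneg _)

theorem gnSeminorm_star (a : A) : gnSeminorm (star a) = gnSeminorm a := by
  have key (a : A) : gnSeminorm a ≤ gnSeminorm (star a) := by
    rcases (gnSeminorm_nonneg a).eq_or_lt with h | h
    · rw [← h]; exact gnSeminorm_nonneg _
    · exact le_of_mul_le_mul_right ((gnSeminorm_mul_self_le a).trans (gnSeminorm_mul_le _ _)) h
  exact le_antisymm (by simpa using key (star a)) (key a)

end CStar

/-! ### Completing a pre-C*-algebra -/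

section Completion

set_option linter.unusedSectionVars false

variable (B : Type*) [NonUnitalNormedRing B] [StarRing B] [CStarRing B] [NormedSpace ℂ B]
  [IsScalarTower ℂ B B] [SMulCommClass ℂ B B] [StarModule ℂ B]

/-- The completion of a pre-C*-algebra `B` as a normed space. The multiplication and the
involution below are the continuous extensions of those of `B`. -/
def CStarCompletion : Type _ := Completion B

namespace CStarCompletion

instance : NormedAddCommGroup (CStarCompletion B) :=
  inferInstanceAs (NormedAddCommGroup (Completion B))

instance : NormedSpace ℂ (CStarCompletion B) :=
  inferInstanceAs (NormedSpace ℂ (Completion B))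

instance : ContinuousConstSMul ℂ (CStarCompletion B) :=
  inferInstance

instance : CompleteSpace (CStarCompletion B) :=
  inferInstanceAs (CompleteSpace (Completion B))

variable {B}

/-- The canonical isometric embedding of `B` in its completion. -/
def of (b : B) : CStarCompletion B := (b : Completion B)

theorem isDenseInducing_of : IsDenseInducing (of : B → CStarCompletion B) :=
  Completion.isDenseInducing_coe

theorem continuous_of : Continuous (of : B → CStarCompletion B) := Completion.continuous_coe B

theorem norm_of (b : B) : ‖of b‖ = ‖b‖ := Completion.norm_coe b

theorem of_add (a b : B) : of (a + b) = of a + of b := Completion.coe_add a b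

theorem of_zero : of (0 : B) = 0 := Completion.coe_zero

theorem of_smul (c : ℂ) (b : B) : of (c • b) = c • of b := Completion.coe_smul c b

theorem induction_on {p : CStarCompletion B → Prop} (x : CStarCompletion B)
    (hp : IsClosed {x | p x}) (ih : ∀ b, p (of b)) : p x :=
  Completion.induction_on x hp ih

theorem induction_on₂ {p : CStarCompletion B → CStarCompletion B → Prop}
    (x y : CStarCompletion B)
    (hp : IsClosed {x : CStarCompletion B × CStarCompletion B | p x.1 x.2})
    (ih : ∀ a b, p (of a) (of b)) : p x y :=
  Completion.induction_on₂ x y hp ih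

theorem induction_on₃ {p : CStarCompletion B → CStarCompletion B → CStarCompletion B → Prop}
    (x y z : CStarCompletion B)
    (hp : IsClosed {x : CStarCompletion B × CStarCompletion B × CStarCompletion B |
      p x.1 x.2.1 x.2.2})
    (ih : ∀ a b c, p (of a) (of b) (of c)) : p x y z :=
  Completion.induction_on₃ x y z hp ih

instance : Mul (CStarCompletion B) :=
  ⟨Function.curry <| (isDenseInducing_of.prodMap isDenseInducing_of).extend
    (of ∘ Function.uncurry (fun a b : B => a * b))⟩

theorem of_mul (a b : B) : of (a * b) = of a * of b :=
  ((isDenseInducing_of.prodMap isDenseInducing_of).extend_eq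
    (continuous_of.comp continuous_mul) (a, b)).symm

instance : ContinuousMul (CStarCompletion B) where
  continuous_mul := by
    let m := (AddMonoidHom.mul : B →+ B →+ B).compr₂ (Completion.toCompl : B →+ Completion B)
    have hm : Continuous fun p : B × B => m p.1 p.2 :=
      (Completion.continuous_coe B).comp continuous_mul
    have di : IsDenseInducing (Completion.toCompl : B → Completion B) :=
      Completion.isDenseInducing_coe
    exact (di.extend_Z_bilin di hm :)

instance : NonUnitalNormedRing (CStarCompletion B) where
  __ := (inferInstance : NormedAddCommGroup (CStarCompletion B))
  __ := (inferInstance : Mul (CStarCompletion B))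
  zero_mul a := by
    induction a using induction_on with
    | hp => exact isClosed_eq (by fun_prop) continuous_const
    | ih a => rw [← of_zero, ← of_mul, zero_mul]
  mul_zero a := by
    induction a using induction_on with
    | hp => exact isClosed_eq (by fun_prop) continuous_const
    | ih a => rw [← of_zero, ← of_mul, mul_zero]
  mul_assoc a b c := by
    induction a, b, c using induction_on₃ with
    | hp => exact isClosed_eq (by fun_prop) (by fun_prop)
    | ih a b c => rw [← of_mul, ← of_mul, ← of_mul, ← of_mul, mul_assoc]
  left_distrib a b c := by
    induction a, b, c using induction_on₃ with
    | hp => exact isClosed_eq (by fun_prop) (by fun_prop)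
    | ih a b c => rw [← of_add, ← of_mul, ← of_mul, ← of_mul, ← of_add, mul_add]
  right_distrib a b c := by
    induction a, b, c using induction_on₃ with
    | hp => exact isClosed_eq (by fun_prop) (by fun_prop)
    | ih a b c => rw [← of_add, ← of_mul, ← of_mul, ← of_mul, ← of_add, add_mul]
  norm_mul_le a b := by
    induction a, b using induction_on₂ with
    | hp => exact isClosed_le (by fun_prop) (by fun_prop)
    | ih a b => rw [← of_mul, norm_of, norm_of, norm_of]; exact norm_mul_le a b

instance : Star (CStarCompletion B) :=
  ⟨Completion.map (star : B → B)⟩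

theorem of_star (b : B) : of (star b) = star (of b) :=
  (Completion.map_coe starNormedAddGroupHom.uniformContinuous b).symm

instance : ContinuousStar (CStarCompletion B) where
  continuous_star := (Completion.continuous_map : Continuous (Completion.map (star : B → B)))

instance : StarRing (CStarCompletion B) where
  star_involutive a := by
    induction a using induction_on with
    | hp => exact isClosed_eq (by fun_prop) continuous_id
    | ih a => rw [← of_star, ← of_star, star_star]
  star_mul a b := by
    induction a, b using induction_on₂ with
    | hp => exact isClosed_eq (by fun_prop) (by fun_prop)
    | ih a b => rw [← of_mul, ← of_star, ← of_star, ← of_star, ← of_mul, star_mul]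
  star_add a b := by
    induction a, b using induction_on₂ with
    | hp => exact isClosed_eq (by fun_prop) (by fun_prop)
    | ih a b => rw [← of_add, ← of_star, ← of_star, ← of_star, ← of_add, star_add]

instance : CStarRing (CStarCompletion B) where
  norm_mul_self_le a := by
    induction a using induction_on with
    | hp => exact isClosed_le (by fun_prop) (by fun_prop)
    | ih a => rw [← of_star, ← of_mul, norm_of, norm_of]; exact CStarRing.norm_mul_self_le a

instance : IsScalarTower ℂ (CStarCompletion B) (CStarCompletion B) where
  smul_assoc c a b := by
    induction a, b using induction_on₂ with
    | hp => exact isClosed_eq ((continuous_fst.const_smul c).mul continuous_snd)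
              ((continuous_fst.mul continuous_snd).const_smul c)
    | ih a b => simp only [smul_eq_mul, ← of_smul, ← of_mul, smul_mul_assoc]

instance : SMulCommClass ℂ (CStarCompletion B) (CStarCompletion B) where
  smul_comm c a b := by
    induction a, b using induction_on₂ with
    | hp => exact isClosed_eq ((continuous_fst.mul continuous_snd).const_smul c)
              (continuous_fst.mul (continuous_snd.const_smul c))
    | ih a b => simp only [smul_eq_mul, ← of_smul, ← of_mul, mul_smul_comm]

instance : StarModule ℂ (CStarCompletion B) where
  star_smul c a := by
    induction a using induction_on with
    | hp => exact isClosed_eq (continuous_id.const_smul c).star (continuous_star.fun_const_smul (star c))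
    | ih a => rw [← of_smul, ← of_star, ← of_star, ← of_smul, star_smul]

instance : NonUnitalCStarAlgebra (CStarCompletion B) where

end CStarCompletion

end Completion

/-! ### The enveloping C*-algebra -/

section Enveloping

variable (A : Type*) [NonUnitalCStarAlgebra A]

/-- The *-algebra `A`, with its norm forgotten and replaced by the seminorm `‖·‖_o`. -/
def WithGNSeminorm : Type _ := A

namespace WithGNSeminorm

instance : NonUnitalRing (WithGNSeminorm A) := inferInstanceAs (NonUnitalRing A)
instance : Module ℂ (WithGNSeminorm A) := inferInstanceAs (Module ℂ A)
instance : IsScalarTower ℂ (WithGNSeminorm A) (WithGNSeminorm A) :=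
  inferInstanceAs (IsScalarTower ℂ A A)
instance : SMulCommClass ℂ (WithGNSeminorm A) (WithGNSeminorm A) :=
  inferInstanceAs (SMulCommClass ℂ A A)
instance : StarRing (WithGNSeminorm A) := inferInstanceAs (StarRing A)
instance : StarModule ℂ (WithGNSeminorm A) := inferInstanceAs (StarModule ℂ A)

instance : SeminormedAddCommGroup (WithGNSeminorm A) :=
  AddGroupSeminorm.toSeminormedAddCommGroup (E := WithGNSeminorm A)
    { toFun := fun a => gnSeminorm (A := A) a
      map_zero' := gnSeminorm_zero (A := A)
      add_le' := gnSeminorm_add_le (A := A)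
      neg' := gnSeminorm_neg (A := A) }

theorem norm_def (a : WithGNSeminorm A) : ‖a‖ = gnSeminorm (A := A) a := rfl

instance : NonUnitalSeminormedRing (WithGNSeminorm A) where
  __ := (inferInstance : SeminormedAddCommGroup (WithGNSeminorm A))
  __ := (inferInstance : NonUnitalRing (WithGNSeminorm A))
  norm_mul_le := gnSeminorm_mul_le (A := A)

instance : NormedSpace ℂ (WithGNSeminorm A) where
  norm_smul_le := gnSeminorm_smul_le (A := A)

instance : NormedStarGroup (WithGNSeminorm A) where
  norm_star_le a := (gnSeminorm_star (A := A) a).le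

end WithGNSeminorm

/-- The quotient of `A` by the *-radical `{a | ‖a‖_o = 0}`, normed by
`‖a + rad‖ = ‖a‖_o`. -/
abbrev RadicalQuotient : Type _ := SeparationQuotient (WithGNSeminorm A)

namespace RadicalQuotient

variable {A} in
/-- The quotient map from `A`. -/
def mk (a : A) : RadicalQuotient A := SeparationQuotient.mk (X := WithGNSeminorm A) a

variable {A} in
theorem norm_mk (a : A) : ‖mk a‖ = gnSeminorm a := rfl

variable {A} in
theorem mk_eq_mk_iff (a b : A) : mk a = mk b ↔ gnSeminorm (a - b) = 0 := by
  rw [← sub_eq_zero, ← norm_eq_zero]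
  exact Iff.rfl

instance : Star (RadicalQuotient A) where
  star := Quotient.map' star fun _ _ h => h.map continuous_star

theorem mk_star (a : A) : mk (star a) = star (mk a) := rfl

instance : StarRing (RadicalQuotient A) where
  star_involutive := SeparationQuotient.surjective_mk.forall.mpr fun a =>
    congrArg SeparationQuotient.mk (star_star a)
  star_mul := SeparationQuotient.surjective_mk.forall₂.mpr fun a b =>
    congrArg SeparationQuotient.mk (star_mul a b)
  star_add := SeparationQuotient.surjective_mk.forall₂.mpr fun a b =>
    congrArg SeparationQuotient.mk (star_add a b)

instance : StarModule ℂ (RadicalQuotient A) where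
  star_smul c := SeparationQuotient.surjective_mk.forall.mpr fun a =>
    congrArg SeparationQuotient.mk (star_smul c a)

instance : IsScalarTower ℂ (RadicalQuotient A) (RadicalQuotient A) where
  smul_assoc c := SeparationQuotient.surjective_mk.forall₂.mpr fun a b =>
    congrArg SeparationQuotient.mk (smul_mul_assoc c a b)

instance : SMulCommClass ℂ (RadicalQuotient A) (RadicalQuotient A) where
  smul_comm c := SeparationQuotient.surjective_mk.forall₂.mpr fun a b =>
    congrArg SeparationQuotient.mk (mul_smul_comm c a b).symm

instance : CStarRing (RadicalQuotient A) where
  norm_mul_self_le := SeparationQuotient.surjective_mk.forall.mpr fun a =>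
    gnSeminorm_mul_self_le (A := A) a

end RadicalQuotient

/-- The enveloping C*-algebra `C*(A)`: the completion of the quotient of `A` by its
*-radical, in the norm induced by `‖·‖_o`. -/
abbrev EnvelopingCStarAlgebra : Type _ := CStarCompletion (RadicalQuotient A)

/-- The canonical *-homomorphism `j : A → C*(A)`, `a ↦ a + rad`. -/
def toEnveloping : A →⋆ₙₐ[ℂ] EnvelopingCStarAlgebra A where
  toFun a := CStarCompletion.of (RadicalQuotient.mk a)
  map_smul' c a := CStarCompletion.of_smul c (RadicalQuotient.mk a)
  map_zero' := CStarCompletion.of_zero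
  map_add' a b := CStarCompletion.of_add (RadicalQuotient.mk a) (RadicalQuotient.mk b)
  map_mul' a b := CStarCompletion.of_mul (RadicalQuotient.mk a) (RadicalQuotient.mk b)
  map_star' a := CStarCompletion.of_star (RadicalQuotient.mk a)

end Enveloping

end GelfandNaimark

end

namespace GelfandNaimark

open scoped ComplexOrder InnerProductSpace

/-! ### Norming positive functionals on a unital C*-algebra. -/

section Unital

variable {B : Type*} [CStarAlgebra B] [PartialOrder B] [StarOrderedRing B]

/-! Everything rests on the equality `‖a‖_o = ‖a‖`. States have norm at most one, which gives `≤`;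
for `≥` one needs a state `ψ` with `ψ(a* a) = ‖a‖²`. With `h = a* a` in the unitization, Hahn–Banach
norms `1 + h`. Since `‖1 + h‖ = 1 + ‖h‖`, the functional must take the value `1` at `1` and have
real part `‖h‖` at `h`. Having norm at most one and the value one at `1` makes it positive, up to
symmetrization, and its restriction to `A` is the state sought (`exists_state_apply_eq_norm_sq`).

Hence the states separate points and `π_u` is injective. An injective *-homomorphism of C*-algebras
is isometric, so its range is closed. Likewise `j` is isometric with dense range, and completeness
of `A` makes it onto. -/

theorem norm_one_add_of_nonneg [Nontrivial B] {h : B} (hh : 0 ≤ h) : ‖1 + h‖ = 1 + ‖h‖ := by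
  refine le_antisymm ((norm_add_le _ _).trans_eq (by rw [norm_one])) ?_
  -- For `h ≥ 0` the norm is itself a spectral value, and adding `1` translates the spectrum.
  have h1 : (1 + ‖h‖ : ℝ) ∈ spectrum ℝ (1 + h) := by
    have := (spectrum.add_mem_add_iff (R := ℝ) (s := 1)).mpr
      (CStarAlgebra.norm_mem_spectrum_of_nonneg (a := h) hh)
    simpa [add_comm] using this
  exact (le_abs_self _).trans (spectrum.norm_le_norm_of_mem h1)

/-- A functional of norm at most one that takes the value one at `1` has nonnegative real part on
nonnegative elements. -/
theorem re_nonneg_of_norm_le_one {f : StrongDual ℂ B} (hf : ‖f‖ ≤ 1) (hf1 : f 1 = 1)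
    {b : B} (hb : 0 ≤ b) : 0 ≤ (f b).re := by
  -- From `0 ≤ b ≤ ‖b‖` the element `‖b‖ - b` has norm at most `‖b‖`. So `f b` lies in the closed
  -- disc of centre and radius `‖b‖`, which is in the right half-plane.
  have hnorm : ‖algebraMap ℝ B ‖b‖ - b‖ ≤ ‖b‖ := by
    refine (CStarAlgebra.norm_le_iff_le_algebraMap _ (norm_nonneg b) ?_).mpr ?_
    · exact sub_nonneg.mpr (IsSelfAdjoint.le_algebraMap_norm_self (.of_nonneg hb))
    · exact sub_le_self _ hb
  have h1 : f (algebraMap ℝ B ‖b‖ - b) = ‖b‖ - f b := by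
    rw [map_sub, Algebra.algebraMap_eq_smul_one, ← Complex.coe_smul, map_smul, hf1]
    simp
  have h2 : ‖(‖b‖ : ℂ) - f b‖ ≤ ‖b‖ := by
    rw [← h1]
    exact (f.le_of_opNorm_le hf _).trans (by rwa [one_mul])
  have h3 := (Complex.re_le_norm _).trans h2
  simpa using h3

/-- Every nonnegative element of a unital C*-algebra is normed by a unital positive functional. -/
theorem exists_positive_apply_eq_norm [Nontrivial B] {h : B} (hh : 0 ≤ h) :
    ∃ f : B →ₚ[ℂ] ℂ, f 1 = 1 ∧ f h = ‖h‖ := by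
  -- Norming `1 + h` instead of `h` controls both values at once: the real parts at `1` and `h` are
  -- bounded by `1` and `‖h‖`, and their sum attains the sum of the bounds.
  obtain ⟨g, hg, hgh⟩ := exists_dual_vector'' ℂ (1 + h)
  have hg1 : ‖g 1‖ ≤ 1 := by simpa using g.le_of_opNorm_le hg 1
  have hg2 : ‖g h‖ ≤ ‖h‖ := by simpa using g.le_of_opNorm_le hg h
  have hsum : (g 1).re + (g h).re = 1 + ‖h‖ := by
    rw [norm_one_add_of_nonneg hh, map_add] at hgh
    simpa using congrArg Complex.re hgh
  have hr1 := Complex.re_le_norm (g 1)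
  have hr2 := Complex.re_le_norm (g h)
  have e1 : (g 1).re = 1 := by linarith
  have e2 : (g h).re = ‖h‖ := by linarith
  have e1' : g 1 = 1 := by
    have := Complex.re_eq_norm.mp (show (g 1).re = ‖g 1‖ by linarith)
    exact Complex.ext e1 (Complex.nonneg_iff.mp this).2.symm
  -- The Hermitian part of `g` is real on self-adjoint elements, where it equals `Re g`;
  -- nonnegativity of the real part is then enough for positivity.
  let φ : B →ₗ[ℂ] ℂ :=
    { toFun := fun x => (2⁻¹ : ℂ) * (g x + star (g (star x)))
      map_add' := fun x y => by simp only [star_add, map_add]; ring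
      map_smul' := fun c x => by
        simp only [star_smul, map_smul, smul_eq_mul, star_mul', star_star, RingHom.id_apply]
        ring }
  have hφ (x : B) (hx : IsSelfAdjoint x) : φ x = ((g x).re : ℂ) := by
    change (2⁻¹ : ℂ) * (g x + star (g (star x))) = _
    rw [hx.star_eq]
    apply Complex.ext <;> simp
    ring
  refine ⟨PositiveLinearMap.mk₀ φ fun x hx => ?_, ?_, ?_⟩
  · rw [hφ x (.of_nonneg hx)]
    exact Complex.zero_le_real.mpr (re_nonneg_of_norm_le_one hg e1' hx)
  · exact (hφ 1 (.one B)).trans (by rw [e1, Complex.ofReal_one])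
  · exact (hφ h (.of_nonneg hh)).trans (by rw [e2])

/-- The Cauchy–Schwarz inequality for a unital positive functional. -/
theorem norm_apply_sq_le (f : B →ₚ[ℂ] ℂ) (hf : f 1 = 1) (b : B) :
    ‖f b‖ ^ 2 ≤ (f (star b * b)).re := by
  -- Cauchy–Schwarz in the pre-GNS space against the class of `1`, a unit vector because `f 1 = 1`.
  have h := norm_inner_le_norm (𝕜 := ℂ) (f.toPreGNS 1) (f.toPreGNS b)
  rw [f.preGNS_inner_def, f.preGNS_norm_def, f.preGNS_norm_def] at h
  simp only [f.ofPreGNS_toPreGNS, star_one, one_mul, hf, Complex.one_re, Real.sqrt_one] at h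
  have h0 : 0 ≤ (f (star b * b)).re :=
    (Complex.nonneg_iff.mp (f.map_nonneg (star_mul_self_nonneg b))).1
  exact (Real.le_sqrt (norm_nonneg _) h0).mp h

end Unital

/-! ### Norming states of a non-unital algebra. -/

section NonUnital

variable {A : Type*} [NonUnitalCStarAlgebra A]

/-- Every nonzero element is normed by a state. -/
theorem exists_state_apply_eq_norm_sq {a : A} (ha : a ≠ 0) :
    ∃ ψ : State A, ψ.1 (star a * a) = ((‖a‖ ^ 2 : ℝ) : ℂ) := by
  let _ : PartialOrder (Unitization ℂ A) := CStarAlgebra.spectralOrder _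
  have _ : StarOrderedRing (Unitization ℂ A) := CStarAlgebra.spectralOrderedRing _
  obtain ⟨f, hf1, hfh⟩ := exists_positive_apply_eq_norm
    (star_mul_self_nonneg (a : Unitization ℂ A))
  rw [CStarRing.norm_star_mul_self, Unitization.norm_inr, ← sq] at hfh
  let ψ : A →ₗ[ℂ] ℂ := (f : Unitization ℂ A →ₗ[ℂ] ℂ) ∘ₗ Unitization.inrHom ℂ ℂ A
  have hψ (x : A) : ψ x = f (x : Unitization ℂ A) := rfl
  have hψs (x : A) : ψ (star x * x) = f (star (x : Unitization ℂ A) * x) := by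
    rw [hψ, Unitization.inr_mul, Unitization.inr_star]
  have hone : (1 : ℝ) ∈ variationBounds ψ :=
    ⟨zero_le_one, fun x => by rw [one_mul, hψs]; exact norm_apply_sq_le f hf1 _⟩
  have hc : Continuous ψ :=
    (map_continuous f).comp (Unitization.isometry_inr (𝕜 := ℂ) (A := A)).continuous
  have hψa : ψ (star a * a) = ((‖a‖ ^ 2 : ℝ) : ℂ) := by rw [hψs]; exact hfh
  refine ⟨⟨ψ, ⟨fun x => ?_, fun b => ?_, ⟨1, hone⟩, ?_⟩⟩, hψa⟩
  · rw [hψs]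
    exact f.map_nonneg (star_mul_self_nonneg _)
  · exact Continuous.continuousOn (by fun_prop)
  · refine le_antisymm (csInf_le ⟨0, fun v hv => hv.1⟩ hone)
      (le_csInf ⟨1, hone⟩ fun v hv => ?_)
    -- No variation bound `v` is below one: at `h = a* a` it gives `‖a‖⁴ = |ψ(h)|² ≤ v ψ(h* h) ≤ v
    -- ‖a‖⁴`, and `a ≠ 0` permits cancellation.
    have h1 := hv.2 (star a * a)
    have h2 : (ψ (star (star a * a) * (star a * a))).re ≤ (‖a‖ ^ 2) ^ 2 := by
      rw [hψ, Unitization.inr_mul, Unitization.inr_star]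
      refine (Complex.re_le_norm _).trans
        ((f.norm_apply_le_of_nonneg _ (star_mul_self_nonneg _)).trans_eq ?_)
      rw [hf1, norm_one, one_mul, CStarRing.norm_star_mul_self, Unitization.norm_inr,
        CStarRing.norm_star_mul_self]
      ring
    rw [hψa, Complex.norm_real, Real.norm_of_nonneg (by positivity)] at h1
    have hpos : 0 < (‖a‖ ^ 2) ^ 2 := by positivity
    refine le_of_mul_le_mul_right ?_ hpos
    rw [one_mul]
    exact h1.trans (mul_le_mul_of_nonneg_left h2 hv.1)

theorem gnSeminorm_eq_norm (a : A) : gnSeminorm a = ‖a‖ := by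
  refine le_antisymm (Real.iSup_le (fun ψ => ψ.sqrt_le_norm a) (norm_nonneg a)) ?_
  -- The case `a = 0` is separate: the zero algebra has no states.
  rcases eq_or_ne a 0 with rfl | ha
  · rw [norm_zero, gnSeminorm_zero]
  · obtain ⟨ψ, hψ⟩ := exists_state_apply_eq_norm_sq ha
    have := ψ.sqrt_le_gnSeminorm a
    rwa [hψ, Complex.ofReal_re, Real.sqrt_sq (norm_nonneg a)] at this

-- Faithfulness of the universal representation.

attribute [local instance] CStarAlgebra.spectralOrder CStarAlgebra.spectralOrderedRing in
theorem State.apply_eq_zero_of_gnsRep_eq_zero (ψ : State A) {a : A} (h : ψ.gnsRep a = 0) (b : A) :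
    (ψ.1 (star (a * b) * (a * b))).re = 0 := by
  -- `π_ψ(a)` sends the class of `b` to that of `a b`, whose squared norm is the quantity in
  -- question.
  have h1 : ψ.gnsRep a (ψ.toPositive.toPreGNS b : ψ.GNSSpace) = 0 := by rw [h]; rfl
  have h2 := congrArg norm h1
  rw [State.gnsRep, PositiveLinearMap.gnsNonUnitalStarAlgHom_apply_coe,
    UniformSpace.Completion.norm_coe, norm_zero] at h2
  exact (Real.sqrt_eq_zero (ψ.re_nonneg (a * b))).mp h2

theorem gnsRep_eq_zero_of_universalRep_eq_zero {a : A} (h : universalRep A a = 0) (ψ : State A) :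
    ψ.gnsRep a = 0 := by
  classical
  ext x
  -- Each `H_ψ` sits in the direct sum as one coordinate, so `π_u(a)` can be tested on vectors
  -- supported there.
  have := universalRep_apply a (lp.single 2 ψ x) ψ
  rw [h] at this
  simpa using this.symm

/-- Without a unit, the vanishing of `π_ψ(a)` is visible only on products `a b`. Taking `b = a*` for
every `ψ` gives `‖a a*‖_o = 0`, hence `a a* = 0` and `a = 0`. -/
theorem universalRep_injective : Function.Injective (universalRep A) := by
  refine (injective_iff_map_eq_zero _).mpr fun a ha => ?_
  have key : gnSeminorm (a * star a) = 0 :=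
    le_antisymm (Real.iSup_le (fun ψ => by
      rw [ψ.apply_eq_zero_of_gnsRep_eq_zero (gnsRep_eq_zero_of_universalRep_eq_zero ha ψ),
        Real.sqrt_zero]) le_rfl) (gnSeminorm_nonneg _)
  rw [gnSeminorm_eq_norm, norm_eq_zero] at key
  exact (CStarRing.mul_star_self_eq_zero_iff a).mp key

theorem norm_universalRep (a : A) : ‖universalRep A a‖ = ‖a‖ :=
  NonUnitalStarAlgHom.norm_map (universalRep A) universalRep_injective a

/-! ### Isometry of both maps and surjectivity of `j`. -/

theorem norm_toEnveloping (a : A) : ‖toEnveloping A a‖ = ‖a‖ :=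
  (CStarCompletion.norm_of (RadicalQuotient.mk a)).trans
    ((RadicalQuotient.norm_mk a).trans (gnSeminorm_eq_norm a))

theorem isometry_universalRep : Isometry (universalRep A) :=
  AddMonoidHomClass.isometry_of_norm _ norm_universalRep

theorem isometry_toEnveloping : Isometry (toEnveloping A) :=
  AddMonoidHomClass.isometry_of_norm _ norm_toEnveloping

theorem denseRange_toEnveloping : DenseRange (toEnveloping A) :=
  (CStarCompletion.isDenseInducing_of (B := RadicalQuotient A)).dense.comp
    (SeparationQuotient.surjective_mk (X := WithGNSeminorm A)).denseRange
    CStarCompletion.continuous_of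

/-- The isometric image of the complete space `A` is closed, and it is dense. -/
theorem toEnveloping_surjective : Function.Surjective (toEnveloping A) := by
  have hcl := isometry_toEnveloping (A := A) |>.isClosedEmbedding.isClosed_range
  exact Set.range_eq_univ.mp (hcl.closure_eq.symm.trans denseRange_toEnveloping.closure_range)

end NonUnital

end GelfandNaimark

theorem mainTheorem2 {A : Type*} [NonUnitalCStarAlgebra A] :
    -- the universal representation is isometric, and its norm is the Gelfand-Naimark seminorm
    (∀ a : A, ‖GelfandNaimark.universalRep A a‖ = GelfandNaimark.gnSeminorm a ∧
      GelfandNaimark.gnSeminorm a = ‖a‖) ∧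
    -- it is an isomorphism of C*-algebras from `A` onto a C*-algebra of bounded operators
    (IsClosed (NonUnitalStarAlgHom.range (GelfandNaimark.universalRep A) :
        Set (GelfandNaimark.UniversalSpace A →L[ℂ] GelfandNaimark.UniversalSpace A)) ∧
      ∃ e : A ≃⋆ₐ[ℂ] NonUnitalStarAlgHom.range (GelfandNaimark.universalRep A),
        Isometry e ∧ ∀ a : A,
          (e a : GelfandNaimark.UniversalSpace A →L[ℂ] GelfandNaimark.UniversalSpace A) =
            GelfandNaimark.universalRep A a) ∧
    -- the canonical map `A → C*(A)` is an isomorphism of C*-algebras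
    (∃ e : A ≃⋆ₐ[ℂ] GelfandNaimark.EnvelopingCStarAlgebra A,
      Isometry e ∧ ∀ a : A, e a = GelfandNaimark.toEnveloping A a) := by
  have hu := GelfandNaimark.isometry_universalRep (A := A)
  have hj := GelfandNaimark.isometry_toEnveloping (A := A)
  refine ⟨fun a => ⟨(GelfandNaimark.norm_universalRep a).trans
    (GelfandNaimark.gnSeminorm_eq_norm a).symm, GelfandNaimark.gnSeminorm_eq_norm a⟩,
    ⟨?_, ?_⟩, ?_⟩
  · rw [NonUnitalStarAlgHom.coe_range]
    exact hu.isClosedEmbedding.isClosed_range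
  · refine ⟨StarAlgEquiv.ofBijective
      (NonUnitalStarAlgHom.rangeRestrict (GelfandNaimark.universalRep A))
      ⟨fun a b hab => hu.injective (congrArg Subtype.val hab), ?_⟩, ?_, fun a => rfl⟩
    · rintro ⟨_, a, rfl⟩
      exact ⟨a, rfl⟩
    · exact fun a b => hu a b
  · exact ⟨StarAlgEquiv.ofBijective (GelfandNaimark.toEnveloping A)
      ⟨hj.injective, GelfandNaimark.toEnveloping_surjective⟩, hj, fun a => rfl⟩
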